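/- Let $H$ be an infinite-dimensional complex Hilbert space and $d \in \mathbb{N}$. Let $X$ be the set of all $d$-tuples $(S_1,\dots,S_d)$ of pairwise commuting contractions on $H$ (bounded linear operators of norm at most $1$), equipped with the weak polynomial (PW) topology, i.e. the coarsest topology for which the maps $(S_1,\dots,S_d)\mapsto \prod_{i=1}^{d}S_i^{n_i}$, $(n_1,\dots,n_d)\in\mathbb{N}_0^d$, are continuous into the bounded operators on $H$ with the weak operator topology. Let $E_d \subseteq X$ be the set of those tuples which satisfy the von Neumann inequality $$\|p(S_1,\dots,S_d)\| \le \sup_{\lambda\in\mathbb{T}^d}|p(\lambda_1,\dots,\lambda_d)| \quad\text{for all } p\in\mathbb{C}[X_1,\dots,X_d],$$ where $\mathbb{T}=\{z\in\mathbb{C} : |z|=1\}$. Then: 1. $E_d$ is closed in $X$. 2. If $d\ge 3$, then $E_d\neq X$. 3. If $H$ is moreover separable, then exactly one of the following holds: $E_d = X$, or $E_d$ is meagre in $X$. In particular, if $H$ is separable and $d\ge 3$, then $E_d$ is meagre in $X$; equivalently, the set of commuting $d$-tuples of contractions that violate the von Neumann inequality is residual in $X$. -/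

import Mathlib

/-- The set of commuting `d`-tuples of contractions on the Hilbert space `H`. This is a structure of
its own (rather than a subtype of tuples of operators), so that it carries no other topology than the
weak polynomial topology defined below. -/
@[ext]
structure CommContractions (H : Type*) [NormedAddCommGroup H] [InnerProductSpace ℂ H] (d : ℕ) where
  /-- The operators `S₁, …, S_d`. -/
  op : Fin d → (H →L[ℂ] H)
  norm_op_le : ∀ i, ‖op i‖ ≤ 1
  commute_op : ∀ i j, Commute (op i) (op j)

namespace CommContractions

variable {H : Type*} [NormedAddCommGroup H] [InnerProductSpace ℂ H] {d : ℕ}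

/-- The monomial `S₁ ^ n₁ * ⋯ * S_d ^ n_d` (the factors commute, so the order is immaterial). -/
def monomial (S : CommContractions H d) (n : Fin d → ℕ) : H →L[ℂ] H :=
  (List.ofFn fun i => S.op i ^ n i).prod

/-- The weak polynomial topology: the coarsest topology for which all the monomials
`S ↦ S₁ ^ n₁ * ⋯ * S_d ^ n_d` are continuous into the operators on `H` with the weak operator
topology, so that `S⁽ᵅ⁾ → S` iff every monomial of `S⁽ᵅ⁾` converges weakly to that of `S`. -/
noncomputable instance : TopologicalSpace (CommContractions H d) :=
  ⨅ n : Fin d → ℕ,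
    TopologicalSpace.induced
      (fun S : CommContractions H d =>
        (ContinuousLinearMapWOT.ofCLM (S.monomial n) : H →WOT[ℂ] H))
      ContinuousLinearMapWOT.instTopologicalSpace

/-- The operator `p(S₁, …, S_d)` for a polynomial `p ∈ ℂ[X₁, …, X_d]`. -/
noncomputable def evalPoly (S : CommContractions H d) (p : MvPolynomial (Fin d) ℂ) : H →L[ℂ] H :=
  ∑ n ∈ p.support, p.coeff n • S.monomial n

/-- The von Neumann inequality: `‖p(S₁, …, S_d)‖` is at most the supremum of `|p|` on the torus
`𝕋ᵈ`, for every polynomial `p`. (The supremum is that of a continuous function on a nonempty compact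
space.) -/
def SatisfiesVonNeumann (S : CommContractions H d) : Prop :=
  ∀ p : MvPolynomial (Fin d) ℂ,
    ‖S.evalPoly p‖ ≤ ⨆ z : Fin d → Circle, ‖MvPolynomial.eval (fun i => (z i : ℂ)) p‖

end CommContractions

/-- The set `E_d` of commuting `d`-tuples of contractions satisfying the von Neumann inequality. -/
def vonNeumannTuples (H : Type*) [NormedAddCommGroup H] [InnerProductSpace ℂ H] (d : ℕ) :
    Set (CommContractions H d) :=
  {S | S.SatisfiesVonNeumann}

open Filter Topology
open scoped InnerProductSpace

/-! Everything is read off the scalars `⟪S.monomial n x, y⟫`, whose pointwise convergence is exactly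
the PW topology. The von Neumann inequality is a family of closed conditions on finite combinations
of these scalars, so `E_d` is closed.

For `d ≥ 3` the Kaijser–Varopoulos polynomial z₁² + z₂² + z₃² - 2z₁z₂ - 2z₁z₃ - 2z₂z₃ has modulus at
most 5 on the torus, while three commuting contractions built on five orthonormal vectors give it
norm at least 9/√3 = 3√3 > 5.

If a single tuple `R` violates the inequality, the violators are dense
(`dense_compl_vonNeumannTuples`). Given `S`, take isometries `U k`, `V k` with orthogonal ranges
whose adjoints tend strongly to 1 and 0. The orthogonal sum of `S` on the range of `U k` and `R` on
that of `V k` converges to `S`, yet compresses to `R` and hence violates. A closed set with dense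
complement is meagre.

The two alternatives exclude each other because the space is Baire (`baireSpace`): it embeds as a Gδ
in a compact space of sesquilinear kernels. Multiplicativity is not a closed condition there, but it
is a Gδ one (`range_coeff`). -/

theorem List.prod_ofFn_pow_add {M : Type*} [Monoid M] {d : ℕ} (f : Fin d → M)
    (hf : ∀ i j, Commute (f i) (f j)) (n m : Fin d → ℕ) :
    (List.ofFn fun i => f i ^ (n + m) i).prod =
      (List.ofFn fun i => f i ^ n i).prod * (List.ofFn fun i => f i ^ m i).prod := by
  induction d with
  | zero => simp
  | succ d ih =>
    simp only [List.ofFn_succ, List.prod_cons]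
    have hcomm : Commute (List.ofFn fun i : Fin d => f i.succ ^ n i.succ).prod (f 0 ^ m 0) := by
      refine Commute.list_prod_left _ _ fun x hx => ?_
      obtain ⟨i, rfl⟩ := (List.mem_ofFn' _ _).1 hx
      exact (hf _ _).pow_pow _ _
    have := ih (fun i => f i.succ) (fun i j => hf _ _) (fun i => n i.succ) (fun i => m i.succ)
    simp only [Pi.add_apply] at this ⊢
    rw [this, pow_add, mul_assoc, mul_assoc, ← mul_assoc (f 0 ^ m 0), ← hcomm.eq, mul_assoc]

/-- A property of exponent vectors that holds at `0` and at the unit vectors and is stable under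
addition holds everywhere. -/
theorem Pi.nat_induction_add {d : ℕ} {P : (Fin d → ℕ) → Prop} (zero : P 0)
    (hadd : ∀ n m, P n → P m → P (n + m)) (single : ∀ i, P (Pi.single i 1)) (n : Fin d → ℕ) :
    P n := by
  have hn : n = ∑ i, n i • Pi.single i 1 := by
    ext j
    simp [Finset.sum_apply, Pi.single_apply]
  rw [hn]
  refine Finset.sum_induction _ P hadd zero fun i _ => ?_
  induction n i with
  | zero => simpa using zero
  | succ k ih => rw [succ_nsmul]; exact hadd _ _ ih (single i)

/-! ### Monomials and polynomials of a commuting tuple. -/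

namespace CommContractions

variable {H : Type*} [NormedAddCommGroup H] [InnerProductSpace ℂ H] {d : ℕ}

theorem monomial_zero (S : CommContractions H d) : S.monomial 0 = 1 := by
  simp [monomial]

theorem monomial_add (S : CommContractions H d) (n m : Fin d → ℕ) :
    S.monomial (n + m) = S.monomial n * S.monomial m :=
  List.prod_ofFn_pow_add S.op S.commute_op n m

theorem monomial_single (S : CommContractions H d) (i : Fin d) :
    S.monomial (Pi.single i 1) = S.op i := by
  have key : ∀ {M : Type _} [Monoid M] {d : ℕ} (f : Fin d → M) (i : Fin d),
      (List.ofFn fun j => f j ^ (Pi.single i 1 : Fin d → ℕ) j).prod = f i := by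
    intro M _ d f i
    induction d with
    | zero => exact i.elim0
    | succ d ih =>
      rw [List.ofFn_succ, List.prod_cons]
      refine Fin.cases ?_ (fun i => ?_) i
      · have : (List.ofFn fun j : Fin d => f j.succ ^ (Pi.single 0 1 : Fin (d + 1) → ℕ) j.succ)
            = List.replicate d 1 := by
          rw [← List.ofFn_const]
          congr 1
          ext j
          simp
        rw [this]
        simp
      · have h0 : (Pi.single i.succ 1 : Fin (d + 1) → ℕ) 0 = 0 := by
          simp [(Fin.succ_ne_zero i).symm]
        rw [h0, pow_zero, one_mul]
        convert ih (fun j => f j.succ) i using 5 with j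
        simp [Pi.single_apply]
  exact key S.op i

theorem norm_monomial_le (S : CommContractions H d) (n : Fin d → ℕ) : ‖S.monomial n‖ ≤ 1 := by
  refine Pi.nat_induction_add (P := fun n => ‖S.monomial n‖ ≤ 1) ?_ ?_ ?_ n
  · rw [monomial_zero]
    exact ContinuousLinearMap.norm_id_le
  · intro n m hn hm
    rw [monomial_add]
    exact (norm_mul_le _ _).trans (mul_le_one₀ hn (norm_nonneg _) hm)
  · intro i
    rw [monomial_single]
    exact S.norm_op_le i

/-- A multiplicative family of contractions is the family of monomials of a commuting tuple. -/
theorem exists_monomial_eq (T : (Fin d → ℕ) → H →L[ℂ] H) (h0 : T 0 = 1)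
    (hadd : ∀ n m, T (n + m) = T n * T m) (hT : ∀ n, ‖T n‖ ≤ 1) :
    ∃ S : CommContractions H d, ∀ n, S.monomial n = T n := by
  refine ⟨⟨fun i => T (Pi.single i 1), fun i => hT _, fun i j => ?_⟩, fun n => ?_⟩
  · rw [Commute, SemiconjBy, ← hadd, ← hadd, add_comm]
  · refine Pi.nat_induction_add (P := fun n => monomial _ n = T n) ?_ ?_ ?_ n
    · rw [h0, monomial_zero]
    · intro n m hn hm
      rw [monomial_add, hn, hm, hadd]
    · intro i
      rw [monomial_single]

theorem evalPoly_eq_sum_of_subset (S : CommContractions H d) (p : MvPolynomial (Fin d) ℂ)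
    {s : Finset (Fin d →₀ ℕ)} (hs : p.support ⊆ s) :
    S.evalPoly p = ∑ n ∈ s, p.coeff n • S.monomial n :=
  Finset.sum_subset hs fun n _ hn => by rw [MvPolynomial.notMem_support_iff.1 hn, zero_smul]

theorem evalPoly_add (S : CommContractions H d) (p q : MvPolynomial (Fin d) ℂ) :
    S.evalPoly (p + q) = S.evalPoly p + S.evalPoly q := by
  classical
  rw [S.evalPoly_eq_sum_of_subset (p + q) MvPolynomial.support_add,
    S.evalPoly_eq_sum_of_subset p Finset.subset_union_left,
    S.evalPoly_eq_sum_of_subset q Finset.subset_union_right, ← Finset.sum_add_distrib]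
  simp only [MvPolynomial.coeff_add, add_smul]

theorem evalPoly_monomial (S : CommContractions H d) (n : Fin d →₀ ℕ) (c : ℂ) :
    S.evalPoly (MvPolynomial.monomial n c) = c • S.monomial n := by
  rw [S.evalPoly_eq_sum_of_subset _ MvPolynomial.support_monomial_subset, Finset.sum_singleton,
    MvPolynomial.coeff_monomial, if_pos rfl]

theorem evalPoly_mul_X (S : CommContractions H d) (c : ℂ) (i j : Fin d) :
    S.evalPoly (MvPolynomial.C c * MvPolynomial.X i * MvPolynomial.X j) =
      c • (S.op i * S.op j) := by
  have h : MvPolynomial.C c * MvPolynomial.X i * MvPolynomial.X j =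
      MvPolynomial.monomial (Finsupp.single i 1 + Finsupp.single j 1) c := by
    rw [MvPolynomial.X, MvPolynomial.X, MvPolynomial.C_mul_monomial, MvPolynomial.monomial_mul]
    simp
  rw [h, evalPoly_monomial, Finsupp.coe_add, Finsupp.single_eq_pi_single,
    Finsupp.single_eq_pi_single, monomial_add, monomial_single, monomial_single]

/-- The matrix coefficients of all the monomials of a tuple. -/
noncomputable def coeff (S : CommContractions H d) (n : Fin d → ℕ) (x y : H) : ℂ :=
  ⟪S.monomial n x, y⟫_ℂ

theorem norm_coeff_le (S : CommContractions H d) (n : Fin d → ℕ) (x y : H) :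
    ‖S.coeff n x y‖ ≤ ‖x‖ * ‖y‖ := by
  refine (norm_inner_le_norm _ _).trans ?_
  gcongr
  simpa using (S.monomial n).le_of_opNorm_le (S.norm_monomial_le n) x

theorem coeff_injective : Function.Injective (coeff : CommContractions H d → _) := by
  intro S T h
  have hm : ∀ n, S.monomial n = T.monomial n := fun n =>
    ContinuousLinearMap.ext fun x => ext_inner_right ℂ fun y => congrFun₃ h n x y
  ext1
  ext1 i
  simpa only [monomial_single] using hm (Pi.single i 1)

/-! ### The PW topology through matrix coefficients, and closedness. -/

variable [CompleteSpace H]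

theorem isInducing_coeff : IsInducing (coeff : CommContractions H d → _) := by
  refine isInducing_iff_nhds.2 fun S => le_antisymm ?_ ?_
  · rw [← tendsto_iff_comap]
    refine tendsto_pi_nhds.2 fun n => tendsto_pi_nhds.2 fun x => tendsto_pi_nhds.2 fun y => ?_
    have h : Tendsto (fun S : CommContractions H d =>
        (ContinuousLinearMapWOT.ofCLM (S.monomial n) : H →WOT[ℂ] H)) (𝓝 S)
        (𝓝 (ContinuousLinearMapWOT.ofCLM (S.monomial n))) := by
      rw [instTopologicalSpace, nhds_iInf]
      refine tendsto_iInf' n ?_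
      rw [nhds_induced]
      exact tendsto_comap
    have := ContinuousLinearMapWOT.tendsto_iff_forall_inner_apply_tendsto.1 h x y
    -- The weak operator topology is tested with the operator in the second slot of the inner
    -- product, `coeff` has it in the first; conjugation swaps them.
    have h2 := (Complex.continuous_conj.tendsto _).comp this
    simpa [Function.comp_def, coeff, inner_conj_symm] using h2
  · rw [instTopologicalSpace, nhds_iInf (a := S)]
    rw [le_iInf_iff]
    intro n
    rw [nhds_induced, ← tendsto_iff_comap]
    refine ContinuousLinearMapWOT.tendsto_iff_forall_inner_apply_tendsto.2 fun x y => ?_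
    have h : Tendsto (fun T : CommContractions H d => T.coeff n x y)
        (comap coeff (𝓝 S.coeff)) (𝓝 (S.coeff n x y)) :=
      tendsto_pi_nhds.1 (tendsto_pi_nhds.1 (tendsto_pi_nhds.1 tendsto_comap n) x) y
    have h2 := (Complex.continuous_conj.tendsto _).comp h
    simpa [Function.comp_def, coeff, inner_conj_symm] using h2

theorem continuous_coeff (n : Fin d → ℕ) (x y : H) :
    Continuous fun S : CommContractions H d => S.coeff n x y :=
  continuous_pi_iff.1 (continuous_pi_iff.1 (continuous_pi_iff.1
    isInducing_coeff.continuous n) x) y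

theorem tendsto_of_coeff {ι : Type*} {l : Filter ι} {S : ι → CommContractions H d}
    {T : CommContractions H d}
    (h : ∀ n x y, Tendsto (fun k => (S k).coeff n x y) l (𝓝 (T.coeff n x y))) :
    Tendsto S l (𝓝 T) :=
  isInducing_coeff.tendsto_nhds_iff.2
    (tendsto_pi_nhds.2 fun n => tendsto_pi_nhds.2 fun x => tendsto_pi_nhds.2 fun y => h n x y)

theorem continuous_inner_evalPoly (p : MvPolynomial (Fin d) ℂ) (x y : H) :
    Continuous fun S : CommContractions H d => ⟪S.evalPoly p x, y⟫_ℂ := by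
  have h : (fun S : CommContractions H d => ⟪S.evalPoly p x, y⟫_ℂ) =
      fun S => ∑ n ∈ p.support, (starRingEnd ℂ) (p.coeff n) * S.coeff n x y := by
    ext S
    simp [evalPoly, coeff, mul_comm]
  rw [h]
  exact continuous_finsetSum _ fun n _ => continuous_const.mul (continuous_coeff n x y)

end CommContractions

/-- An operator norm bound is a family of bounds on matrix coefficients, and for a fixed polynomial
and fixed vectors these are continuous in the tuple. -/
theorem isClosed_vonNeumannTuples {H : Type*} [NormedAddCommGroup H] [InnerProductSpace ℂ H]
    [CompleteSpace H] (d : ℕ) : IsClosed (vonNeumannTuples H d) := by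
  have h : vonNeumannTuples H d = ⋂ (p : MvPolynomial (Fin d) ℂ) (x : H) (y : H),
      {S | ‖⟪S.evalPoly p x, y⟫_ℂ‖ ≤
        (⨆ z : Fin d → Circle, ‖MvPolynomial.eval (fun i => (z i : ℂ)) p‖) * ‖x‖ * ‖y‖} := by
    ext S
    simp only [vonNeumannTuples, Set.mem_iInter, Set.mem_ofPred_eq,
      CommContractions.SatisfiesVonNeumann]
    refine forall_congr' fun p => ⟨fun hp x y => ?_, fun hp => ?_⟩
    · refine (norm_inner_le_norm _ _).trans ?_
      gcongr
      exact (S.evalPoly p).le_of_opNorm_le hp x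
    · refine ContinuousLinearMap.opNorm_le_of_re_inner_le
        (Real.iSup_nonneg fun _ => norm_nonneg _) fun x y hx hy => ?_
      simpa [hx, hy] using (Complex.re_le_norm _).trans (hp x y)
  rw [h]
  exact isClosed_iInter fun p => isClosed_iInter fun x => isClosed_iInter fun y =>
    isClosed_le (CommContractions.continuous_inner_evalPoly p x y).norm continuous_const

/-! ### The Kaijser–Varopoulos counterexample. -/

/-- On the torus, the discriminant of the cubic with roots `z₁, z₂, z₃` controls the modulus of the
Kaijser–Varopoulos polynomial. -/
theorem Circle.norm_kaijserVaropoulos_sq (z₁ z₂ z₃ : Circle) :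
    ‖(z₁ ^ 2 + z₂ ^ 2 + z₃ ^ 2 - 2 * z₁ * z₂ - 2 * z₁ * z₃ - 2 * z₂ * z₃ : ℂ)‖ ^ 2 =
      27 - 2 * ‖(z₁ + z₂ + z₃ : ℂ)‖ ^ 2 -
        (‖(z₁ - z₂ : ℂ)‖ * ‖(z₂ - z₃ : ℂ)‖ * ‖(z₁ - z₃ : ℂ)‖) ^ 2 := by
  have h (z : ℂ) : ((‖z‖ ^ 2 : ℝ) : ℂ) = z * (starRingEnd ℂ) z := by
    rw [Complex.mul_conj, Complex.normSq_eq_norm_sq]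
  have hc (z : Circle) : (starRingEnd ℂ) (z : ℂ) = (z : ℂ)⁻¹ := by
    rw [← Circle.coe_inv, Circle.coe_inv_eq_conj]
  have h1 := z₁.coe_ne_zero
  have h2 := z₂.coe_ne_zero
  have h3 := z₃.coe_ne_zero
  -- Since conjugation is inversion on the circle, both sides become rational functions of the three
  -- points.
  apply Complex.ofReal_injective
  simp only [mul_pow, Complex.ofReal_sub, Complex.ofReal_mul, h, Complex.ofReal_ofNat, map_add,
    map_sub, map_mul, map_pow, map_ofNat, hc]
  field_simp
  ring

/-- With s = z₁ + z₂ + z₃, the discriminant identity bounds the square by 27 - 2|s|² ≤ 25 when |s| ≥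
1. When |s| ≤ 1, the form s² - 4e₂ with e₂ = z₁z₂z₃ s̄ gives |s|² + 4|s| ≤ 5. -/
theorem Circle.norm_kaijserVaropoulos_le (z₁ z₂ z₃ : Circle) :
    ‖(z₁ ^ 2 + z₂ ^ 2 + z₃ ^ 2 - 2 * z₁ * z₂ - 2 * z₁ * z₃ - 2 * z₂ * z₃ : ℂ)‖ ≤ 5 := by
  set s : ℂ := z₁ + z₂ + z₃ with hs
  rcases le_total 1 ‖s‖ with h | h
  · have := Circle.norm_kaijserVaropoulos_sq z₁ z₂ z₃
    rw [← hs] at this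
    have h0 := sq_nonneg (‖(z₁ - z₂ : ℂ)‖ * ‖(z₂ - z₃ : ℂ)‖ * ‖(z₁ - z₃ : ℂ)‖)
    exact (abs_le_of_sq_le_sq' (by nlinarith) (by norm_num)).2
  · have hc (z : Circle) : (starRingEnd ℂ) (z : ℂ) = (z : ℂ)⁻¹ := by
      rw [← Circle.coe_inv, Circle.coe_inv_eq_conj]
    have h1 := z₁.coe_ne_zero
    have h2 := z₂.coe_ne_zero
    have h3 := z₃.coe_ne_zero
    have key : (z₁ ^ 2 + z₂ ^ 2 + z₃ ^ 2 - 2 * z₁ * z₂ - 2 * z₁ * z₃ - 2 * z₂ * z₃ : ℂ) =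
        s ^ 2 - 4 * (z₁ * z₂ * z₃ * (starRingEnd ℂ) s) := by
      simp only [hs, map_add, hc]
      field_simp
      ring
    rw [key]
    refine (norm_sub_le _ _).trans ?_
    simp only [norm_pow, norm_mul, Circle.norm_coe, RCLike.norm_conj, Complex.norm_ofNat]
    nlinarith [norm_nonneg s]

section RankTwo

variable {H : Type*} [NormedAddCommGroup H] [InnerProductSpace ℂ H]

/-- The operator `x ↦ ⟪a, x⟫ g + ⟪b, x⟫ h`. -/
noncomputable def rankTwo (a b g h : H) : H →L[ℂ] H :=
  (innerSL ℂ a).smulRight g + (innerSL ℂ b).smulRight h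

theorem rankTwo_apply (a b g h x : H) :
    rankTwo a b g h x = ⟪a, x⟫_ℂ • g + ⟪b, x⟫_ℂ • h := by
  simp [rankTwo]

theorem orthonormal_pair {a b : H} (ha : ‖a‖ = 1) (hb : ‖b‖ = 1) (hab : ⟪a, b⟫_ℂ = 0) :
    Orthonormal ℂ ![a, b] := by
  refine ⟨fun i => ?_, fun i j hij => ?_⟩
  · fin_cases i <;> simp [ha, hb]
  · fin_cases i <;> fin_cases j <;> simp_all [inner_eq_zero_symm]

/-- Such an operator is a partial isometry; the bound is Bessel's inequality for the pair `a`, `b`.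
-/
theorem norm_rankTwo_le {a b g h : H} (hab : Orthonormal ℂ ![a, b])
    (hgh : Orthonormal ℂ ![g, h]) : ‖rankTwo a b g h‖ ≤ 1 := by
  refine ContinuousLinearMap.opNorm_le_bound _ zero_le_one fun x => ?_
  have h1 : ‖rankTwo a b g h x‖ ^ 2 = ‖⟪a, x⟫_ℂ‖ ^ 2 + ‖⟪b, x⟫_ℂ‖ ^ 2 := by
    have horth : ⟪⟪a, x⟫_ℂ • g, ⟪b, x⟫_ℂ • h⟫_ℂ = 0 := by
      have : ⟪g, h⟫_ℂ = 0 := by simpa using hgh.2 (show (0 : Fin 2) ≠ 1 by decide)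
      simp [this]
    have := norm_add_sq_eq_norm_sq_add_norm_sq_of_inner_eq_zero _ _ horth
    have hg : ‖g‖ = 1 := by simpa using hgh.1 0
    have hh : ‖h‖ = 1 := by simpa using hgh.1 1
    rw [rankTwo_apply, sq, this, norm_smul, norm_smul, hg, hh]
    ring
  have h2 := hab.sum_inner_products_le (x := x) (s := Finset.univ)
  rw [Fin.sum_univ_two] at h2
  rw [one_mul]
  refine (abs_le_of_sq_le_sq' (h1.trans_le ?_) (norm_nonneg _)).2
  simpa using h2

end RankTwo

section Counterexample

variable {H : Type*} [NormedAddCommGroup H] [InnerProductSpace ℂ H]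

/-- The symmetric matrix with unit rows whose entries are `±1/√3`, positive on the diagonal. -/
noncomputable def kvMatrix (i j : Fin 3) : ℂ := ((if i = j then 1 else -1) / √3 : ℝ)

theorem kvMatrix_comm (i j : Fin 3) : kvMatrix i j = kvMatrix j i := by
  simp only [kvMatrix, eq_comm]

variable (w : Fin 5 → H)

/-- The `i`-th row of `kvMatrix`, as a vector in the span of `w 1, w 2, w 3`. -/
noncomputable def kvRow (i : Fin 3) : H :=
  kvMatrix i 0 • w 1 + kvMatrix i 1 • w 2 + kvMatrix i 2 • w 3

/-- The Kaijser–Varopoulos operators: `T i` maps `w 0` to `w (i + 1)`, and `w (j + 1)` to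
`kvMatrix i j • w 4`. -/
noncomputable def kvOp (i : Fin 3) : H →L[ℂ] H :=
  rankTwo (w 0) (kvRow w i) (w (![1, 2, 3] i)) (w 4)

variable {w}

theorem norm_kvRow (hw : Orthonormal ℂ w) (i : Fin 3) : ‖kvRow w i‖ = 1 := by
  have h3 : (√3 : ℝ) ^ 2 = 3 := Real.sq_sqrt (by norm_num)
  have h30 : (√3 : ℝ) ≠ 0 := by positivity
  have h : ⟪kvRow w i, kvRow w i⟫_ℂ = 1 := by
    have h3c : ((√3 : ℝ) : ℂ) ^ 2 = 3 := by exact_mod_cast h3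
    have h30c : ((√3 : ℝ) : ℂ) ≠ 0 := by exact_mod_cast h30
    simp only [kvRow, inner_add_left, inner_add_right, inner_smul_left, inner_smul_right,
      orthonormal_iff_ite.1 hw, kvMatrix, Complex.conj_ofReal]
    fin_cases i <;> simp <;> field_simp <;> rw [h3c] <;> norm_num
  have h' := inner_self_eq_norm_sq (𝕜 := ℂ) (kvRow w i)
  rw [h, RCLike.one_re, eq_comm] at h'
  exact (pow_eq_one_iff_of_nonneg (norm_nonneg _) two_ne_zero).1 h'

theorem inner_kvRow_succ (hw : Orthonormal ℂ w) (i j : Fin 3) :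
    ⟪kvRow w i, w (![1, 2, 3] j)⟫_ℂ = kvMatrix i j := by
  simp only [kvRow, inner_add_left, inner_smul_left, orthonormal_iff_ite.1 hw, kvMatrix,
    Complex.conj_ofReal]
  fin_cases j <;> simp

theorem norm_kvOp_le (hw : Orthonormal ℂ w) (i : Fin 3) : ‖kvOp w i‖ ≤ 1 := by
  refine norm_rankTwo_le (orthonormal_pair (hw.1 _) (norm_kvRow hw i) ?_)
    (orthonormal_pair (hw.1 _) (hw.1 _) (hw.2 ?_))
  · simp [kvRow, orthonormal_iff_ite.1 hw]
  · fin_cases i <;> decide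

/-- The operators raise a grading: `w 0`, then the span of `w 1, w 2, w 3`, then `w 4`, then zero.
Two steps survive only from `w 0`, and the symmetry of `kvMatrix` then yields commutativity. -/
theorem kvOp_mul (hw : Orthonormal ℂ w) (i j : Fin 3) (x : H) :
    (kvOp w i * kvOp w j) x = (⟪w 0, x⟫_ℂ * kvMatrix i j) • w 4 := by
  have h1 : ⟪w 0, w (![1, 2, 3] j)⟫_ℂ = 0 := hw.2 (by fin_cases j <;> decide)
  have h2 : ⟪w 0, w 4⟫_ℂ = 0 := hw.2 (by decide)
  have h3 : ⟪kvRow w i, w 4⟫_ℂ = 0 := by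
    simp [kvRow, orthonormal_iff_ite.1 hw]
  rw [mul_apply_eq_comp, kvOp, kvOp, rankTwo_apply, rankTwo_apply]
  simp only [inner_add_right, inner_smul_right, h1, h2, h3, inner_kvRow_succ hw]
  simp

theorem kvOp_commute (hw : Orthonormal ℂ w) (i j : Fin 3) : Commute (kvOp w i) (kvOp w j) := by
  ext x
  rw [kvOp_mul hw, kvOp_mul hw, kvMatrix_comm]

/-- For `d ≥ 3` some commuting `d`-tuple of contractions violates the von Neumann inequality. -/
theorem exists_not_satisfiesVonNeumann (hw : Orthonormal ℂ w) {d : ℕ} (hd : 3 ≤ d) :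
    ∃ S : CommContractions H d, ¬ S.SatisfiesVonNeumann := by
  let a : Fin d := ⟨0, by omega⟩
  let b : Fin d := ⟨1, by omega⟩
  let c : Fin d := ⟨2, by omega⟩
  -- Coordinates beyond the first three repeat operator 0; the polynomial does not involve them.
  let r : Fin d → Fin 3 := fun i => if i = b then 1 else if i = c then 2 else 0
  have ra : r a = 0 := by simp [r, a, b, c]
  have rb : r b = 1 := by simp [r]
  have rc : r c = 2 := by simp [r, b, c]
  let S : CommContractions H d :=
    ⟨fun i => kvOp w (r i), fun i => norm_kvOp_le hw _, fun i j => kvOp_commute hw _ _⟩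
  let t (k : ℂ) (i j : Fin d) : MvPolynomial (Fin d) ℂ :=
    MvPolynomial.C k * MvPolynomial.X i * MvPolynomial.X j
  let p : MvPolynomial (Fin d) ℂ :=
    t 1 a a + t 1 b b + t 1 c c + t (-2) a b + t (-2) a c + t (-2) b c
  refine ⟨S, fun hS => ?_⟩
  have hsup : ⨆ z : Fin d → Circle, ‖MvPolynomial.eval (fun i => (z i : ℂ)) p‖ ≤ 5 := by
    refine ciSup_le fun z => ?_
    refine (congrArg norm ?_).trans_le (Circle.norm_kaijserVaropoulos_le (z a) (z b) (z c))
    simp only [p, t, map_add, map_mul, MvPolynomial.eval_C, MvPolynomial.eval_X]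
    ring
  have hS0 : S.evalPoly p (w 0) = ((9 / √3 : ℝ) : ℂ) • w 4 := by
    have h (k : ℂ) (i j : Fin d) :
        S.evalPoly (t k i j) (w 0) = (k * kvMatrix (r i) (r j)) • w 4 := by
      rw [CommContractions.evalPoly_mul_X, smul_apply, kvOp_mul hw,
        orthonormal_iff_ite.1 hw]
      simp [mul_smul]
    simp only [p, CommContractions.evalPoly_add, add_apply, h, ra, rb, rc,
      ← add_smul]
    congr 1
    simp [kvMatrix]
    ring
  have h1 := (S.evalPoly p).le_of_opNorm_le ((hS p).trans hsup) (w 0)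
  rw [hS0, norm_smul, hw.1, hw.1, Complex.norm_real, Real.norm_of_nonneg (by positivity),
    mul_one, mul_one, div_le_iff₀ (by positivity)] at h1
  -- The inequality would read 9 ≤ 5√3, that is 81 ≤ 75.
  nlinarith [Real.sq_sqrt (show (0 : ℝ) ≤ 3 by norm_num)]

end Counterexample

/-! ### Hilbert bases and shifts along injections of the index set. -/

section HilbertBasis

variable {H : Type*} [NormedAddCommGroup H] [InnerProductSpace ℂ H]

theorem HilbertBasis.infinite_of_not_finiteDimensional (hH : ¬ FiniteDimensional ℂ H) {ι : Type*}
    (b : HilbertBasis ι ℂ H) : Infinite ι := by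
  by_contra h
  rw [not_infinite_iff_finite] at h
  have := Fintype.ofFinite ι
  exact hH b.toOrthonormalBasis.toBasis.finiteDimensional_of_finite

theorem Orthonormal.countable_index [TopologicalSpace.SeparableSpace H] {ι : Type*} {e : ι → H}
    (he : Orthonormal ℂ e) : Countable ι := by
  have hd : Pairwise (Function.onFun Disjoint fun i => Metric.ball (e i) (1 / 2)) := by
    intro i j hij
    refine Metric.ball_disjoint_ball ?_
    have h := norm_sub_sq (𝕜 := ℂ) (e i) (e j)
    -- Distinct orthonormal vectors are √2 apart, so balls of radius 1/2 are disjoint.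
    rw [he.2 hij, he.1, he.1, ← dist_eq_norm, map_zero] at h
    nlinarith [dist_nonneg (x := e i) (y := e j)]
  exact hd.countable_of_isOpen_disjoint (fun i => Metric.isOpen_ball)
    fun i => Metric.nonempty_ball.2 (by norm_num)

section

variable {ι : Type*} (b : HilbertBasis ι ℂ H)

theorem HilbertBasis.ext_inner {x y : H} (h : ∀ i, ⟪b i, x⟫_ℂ = ⟪b i, y⟫_ℂ) : x = y := by
  apply b.repr.injective
  ext i
  simpa [b.repr_apply_apply] using h i

theorem HilbertBasis.ext_clm {S T : H →L[ℂ] H} (h : ∀ i, S (b i) = T (b i)) : S = T := by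
  refine ContinuousLinearMap.ext_on (s := Set.range b)
    (Submodule.dense_iff_topologicalClosure_eq_top.2 b.dense_span) ?_
  rintro _ ⟨i, rfl⟩
  exact h i

theorem HilbertBasis.tendsto_zero_of_bounded {C : ℝ} {T : ℕ → H →L[ℂ] H} (hT : ∀ k, ‖T k‖ ≤ C)
    (h : ∀ i, Tendsto (fun k => T k (b i)) atTop (𝓝 0)) (x : H) :
    Tendsto (fun k => T k x) atTop (𝓝 0) := by
  have hC : 0 ≤ C := (norm_nonneg _).trans (hT 0)
  have hspan : ∀ y ∈ Submodule.span ℂ (Set.range b), Tendsto (fun k => T k y) atTop (𝓝 0) := by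
    intro y hy
    induction hy using Submodule.span_induction with
    | mem y hy => obtain ⟨i, rfl⟩ := hy; exact h i
    | zero => simp
    | add y z _ _ hy hz => simpa using hy.add hz
    | smul c y _ hy => simpa using hy.const_smul c
  have hdense : Dense (Submodule.span ℂ (Set.range b) : Set H) :=
    Submodule.dense_iff_topologicalClosure_eq_top.2 b.dense_span
  refine Metric.tendsto_nhds.2 fun ε hε => ?_
  obtain ⟨y, hy, hxy⟩ := hdense.exists_dist_lt x (show 0 < ε / (2 * (C + 1)) by positivity)
  filter_upwards [Metric.tendsto_nhds.1 (hspan y hy) (ε / 2) (half_pos hε)] with k hk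
  rw [dist_zero_right] at hk ⊢
  have h1 : ‖T k (x - y)‖ ≤ C * (ε / (2 * (C + 1))) := by
    refine ((T k).le_of_opNorm_le (hT k) _).trans ?_
    rw [← dist_eq_norm]
    gcongr
  have h2 : C * (ε / (2 * (C + 1))) ≤ ε / 2 := by
    rw [mul_div_assoc', div_le_div_iff₀ (by positivity) two_pos]
    nlinarith
  calc ‖T k x‖ = ‖T k (x - y) + T k y‖ := by rw [map_sub, sub_add_cancel]
    _ ≤ ‖T k (x - y)‖ + ‖T k y‖ := norm_add_le _ _
    _ < ε := by linarith

end

variable [CompleteSpace H]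

theorem exists_orthonormal_nat (hH : ¬ FiniteDimensional ℂ H) :
    ∃ e : ℕ → H, Orthonormal ℂ e := by
  obtain ⟨w, b, -⟩ := exists_hilbertBasis ℂ H
  have := b.infinite_of_not_finiteDimensional hH
  exact ⟨_, b.orthonormal.comp _ (Infinite.natEmbedding w).injective⟩

theorem exists_hilbertBasis_nat [TopologicalSpace.SeparableSpace H]
    (hH : ¬ FiniteDimensional ℂ H) : Nonempty (HilbertBasis ℕ ℂ H) := by
  obtain ⟨w, b, -⟩ := exists_hilbertBasis ℂ H
  have := b.infinite_of_not_finiteDimensional hH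
  have := b.orthonormal.countable_index
  obtain ⟨f⟩ := nonempty_equiv_of_countable (α := ℕ) (β := w)
  refine ⟨HilbertBasis.mk (b.orthonormal.comp f f.injective) ?_⟩
  rw [f.surjective.range_comp, b.dense_span]

/-- The shift of basis vectors along an injective map `f` of the index set. -/
noncomputable def HilbertBasis.shift {ι : Type*} (b : HilbertBasis ι ℂ H) {f : ι → ι}
    (hf : f.Injective) : H →L[ℂ] H :=
  (b.orthonormal.comp f hf).orthogonalFamily.linearIsometry.toContinuousLinearMap ∘L
    b.repr.toContinuousLinearEquiv.toContinuousLinearMap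

variable {ι : Type*} (b : HilbertBasis ι ℂ H) {f g : ι → ι} (hf : f.Injective) (hg : g.Injective)

theorem HilbertBasis.shift_apply (i : ι) : b.shift hf (b i) = b (f i) := by
  classical
  simp [shift, b.repr_self, OrthogonalFamily.linearIsometry_apply_single]

theorem HilbertBasis.adjoint_shift_apply_of_notMem {j : ι} (hj : j ∉ Set.range f) :
    (b.shift hf).adjoint (b j) = 0 := by
  refine b.ext_inner fun i => ?_
  rw [ContinuousLinearMap.adjoint_inner_right, b.shift_apply, inner_zero_right]
  exact b.orthonormal.2 fun h => hj ⟨i, h⟩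

theorem HilbertBasis.adjoint_shift_apply (i : ι) : (b.shift hf).adjoint (b (f i)) = b i := by
  classical
  refine b.ext_inner fun j => ?_
  rw [ContinuousLinearMap.adjoint_inner_right, b.shift_apply, orthonormal_iff_ite.1 b.orthonormal,
    orthonormal_iff_ite.1 b.orthonormal]
  simp [hf.eq_iff]

theorem HilbertBasis.adjoint_shift_mul_self : (b.shift hf).adjoint * b.shift hf = 1 :=
  b.ext_clm fun i => by simp [b.shift_apply, b.adjoint_shift_apply]

theorem HilbertBasis.adjoint_shift_mul_shift (h : ∀ i, g i ∉ Set.range f) :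
    (b.shift hf).adjoint * b.shift hg = 0 :=
  b.ext_clm fun i => by simp [b.shift_apply, b.adjoint_shift_apply_of_notMem hf (h i)]

theorem HilbertBasis.norm_shift_le : ‖b.shift hf‖ ≤ 1 := by
  refine (b.shift hf).opNorm_le_bound zero_le_one fun x => ?_
  simp [shift]

/-- Pairs of isometries with orthogonal ranges, the first of which is asymptotically the
identity. -/
theorem HilbertBasis.exists_asymptotic_splitting (b : HilbertBasis ℕ ℂ H) :
    ∃ U V : ℕ → H →L[ℂ] H, (∀ k, (U k).adjoint * U k = 1) ∧ (∀ k, (V k).adjoint * V k = 1) ∧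
      (∀ k, (U k).adjoint * V k = 0) ∧ (∀ k, (V k).adjoint * U k = 0) ∧
      (∀ x, Tendsto (fun k => (U k).adjoint x) atTop (𝓝 x)) ∧
      (∀ x, Tendsto (fun k => (V k).adjoint x) atTop (𝓝 0)) := by
  -- `f k` fixes the indices below `k` and sends the rest to even numbers from `2k` on. `g k` takes
  -- odd values above `2k`, so the ranges are disjoint and the range of `g k` leaves every fixed
  -- index.
  let f (k i : ℕ) : ℕ := if i < k then i else 2 * i
  let g (k i : ℕ) : ℕ := 2 * (i + k) + 1
  have hf (k) : (f k).Injective := fun i j hij => by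
    simp only [f] at hij
    split_ifs at hij <;> omega
  have hg (k) : (g k).Injective := fun i j hij => by
    simp only [g] at hij
    omega
  have hfg (k i j) : f k i ≠ g k j := by
    simp only [f, g]
    split_ifs <;> omega
  refine ⟨fun k => b.shift (hf k), fun k => b.shift (hg k), fun k => b.adjoint_shift_mul_self _,
    fun k => b.adjoint_shift_mul_self _, fun k => b.adjoint_shift_mul_shift _ _ ?_,
    fun k => b.adjoint_shift_mul_shift _ _ ?_, fun x => ?_, fun x => ?_⟩
  · rintro i ⟨j, hj⟩
    exact hfg k j i hj
  · rintro i ⟨j, hj⟩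
    exact hfg k i j hj.symm
  · have key : Tendsto (fun k => ((b.shift (hf k)).adjoint - 1) x) atTop (𝓝 0) := by
      refine b.tendsto_zero_of_bounded (C := 2) (fun k => ?_) (fun i => ?_) x
      · refine (norm_sub_le _ _).trans ?_
        rw [LinearIsometryEquiv.norm_map]
        have h1 : ‖(1 : H →L[ℂ] H)‖ ≤ 1 := ContinuousLinearMap.norm_id_le
        linarith [b.norm_shift_le (hf k)]
      · refine tendsto_const_nhds.congr' ?_
        filter_upwards [eventually_gt_atTop i] with k hk
        have hfi : f k i = i := if_pos hk
        have := b.adjoint_shift_apply (hf k) i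
        rw [hfi] at this
        simp [this]
    simpa using key.add_const x
  · refine b.tendsto_zero_of_bounded (C := 1) (fun k => ?_) (fun i => ?_) x
    · rw [LinearIsometryEquiv.norm_map]
      exact b.norm_shift_le (hg k)
    · refine tendsto_const_nhds.congr' ?_
      filter_upwards [eventually_gt_atTop i] with k hk
      refine (b.adjoint_shift_apply_of_notMem (hg k) ?_).symm
      rintro ⟨j, hj⟩
      simp only [g] at hj
      omega

end HilbertBasis

/-! ### Orthogonal sums of tuples and density of the violators. -/

namespace CommContractions

variable {H : Type*} [NormedAddCommGroup H] [InnerProductSpace ℂ H] [CompleteSpace H] {d : ℕ}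

section Splitting

variable {U V : H →L[ℂ] H}

/-- The orthogonal sum of `A` and `B`, placed on the ranges of `U` and `V`. -/
noncomputable def _root_.ContinuousLinearMap.glue (U V A B : H →L[ℂ] H) : H →L[ℂ] H :=
  U * A * U.adjoint + V * B * V.adjoint

open ContinuousLinearMap

theorem _root_.ContinuousLinearMap.inner_glue (U V A B : H →L[ℂ] H) (x y : H) :
    ⟪glue U V A B x, y⟫_ℂ =
      ⟪A (U.adjoint x), U.adjoint y⟫_ℂ + ⟪B (V.adjoint x), V.adjoint y⟫_ℂ := by
  simp [glue, ContinuousLinearMap.adjoint_inner_right]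

theorem _root_.ContinuousLinearMap.glue_mul_glue (hU : U.adjoint * U = 1) (hV : V.adjoint * V = 1)
    (hUV : U.adjoint * V = 0) (hVU : V.adjoint * U = 0) (A B A' B' : H →L[ℂ] H) :
    glue U V A B * glue U V A' B' = glue U V (A * A') (B * B') := by
  have h1 : U * A * U.adjoint * (U * A' * U.adjoint) = U * (A * A') * U.adjoint := by
    calc _ = U * A * (U.adjoint * U) * A' * U.adjoint := by simp only [mul_assoc]
      _ = _ := by rw [hU, mul_one]; simp only [mul_assoc]
  have h2 : V * B * V.adjoint * (V * B' * V.adjoint) = V * (B * B') * V.adjoint := by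
    calc _ = V * B * (V.adjoint * V) * B' * V.adjoint := by simp only [mul_assoc]
      _ = _ := by rw [hV, mul_one]; simp only [mul_assoc]
  have h3 : U * A * U.adjoint * (V * B' * V.adjoint) = 0 := by
    calc _ = U * A * (U.adjoint * V) * B' * V.adjoint := by simp only [mul_assoc]
      _ = _ := by rw [hUV]; simp
  have h4 : V * B * V.adjoint * (U * A' * U.adjoint) = 0 := by
    calc _ = V * B * (V.adjoint * U) * A' * U.adjoint := by simp only [mul_assoc]
      _ = _ := by rw [hVU]; simp
  rw [glue, glue, glue, add_mul, mul_add, mul_add, h1, h2, h3, h4, add_zero, zero_add]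

theorem _root_.ContinuousLinearMap.adjoint_mul_glue_mul (hV : V.adjoint * V = 1)
    (hUV : U.adjoint * V = 0) (A B : H →L[ℂ] H) : V.adjoint * glue U V A B * V = B := by
  calc V.adjoint * glue U V A B * V =
        V.adjoint * U * A * (U.adjoint * V) + (V.adjoint * V) * B * (V.adjoint * V) := by
        simp only [glue, mul_add, add_mul, mul_assoc]
    _ = B := by rw [hUV, hV]; simp

theorem _root_.ContinuousLinearMap.norm_glue_le (hU : U.adjoint * U = 1) (hV : V.adjoint * V = 1)
    (hUV : U.adjoint * V = 0) (hVU : V.adjoint * U = 0) {A B : H →L[ℂ] H} (hA : ‖A‖ ≤ 1)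
    (hB : ‖B‖ ≤ 1) : ‖glue U V A B‖ ≤ 1 := by
  have hU' (z : H) : U.adjoint (U z) = z := DFunLike.congr_fun hU z
  have hV' (z : H) : V.adjoint (V z) = z := DFunLike.congr_fun hV z
  have hUV' (z : H) : U.adjoint (V z) = 0 := DFunLike.congr_fun hUV z
  have hVU' (z : H) : V.adjoint (U z) = 0 := DFunLike.congr_fun hVU z
  -- `q` is the projection of `x` onto the sum of the two ranges: ⟪q, x⟫ = ‖q‖², and Cauchy–Schwarz
  -- gives ‖q‖ ≤ ‖x‖.
  have bessel (x : H) : ‖U.adjoint x‖ ^ 2 + ‖V.adjoint x‖ ^ 2 ≤ ‖x‖ ^ 2 := by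
    set q := glue U V 1 1 x with hq
    have h1 : ⟪q, x⟫_ℂ = ((‖U.adjoint x‖ ^ 2 + ‖V.adjoint x‖ ^ 2 : ℝ) : ℂ) := by
      rw [hq, inner_glue]
      simp [inner_self_eq_norm_sq_to_K]
    have h2 : ⟪q, q⟫_ℂ = ((‖U.adjoint x‖ ^ 2 + ‖V.adjoint x‖ ^ 2 : ℝ) : ℂ) := by
      rw [← h1, hq, inner_glue, inner_glue]
      simp [glue, hU', hV', hUV', hVU']
    have h3 : ‖q‖ ^ 2 = ‖U.adjoint x‖ ^ 2 + ‖V.adjoint x‖ ^ 2 := by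
      rw [← inner_self_eq_norm_sq (𝕜 := ℂ), h2]
      exact Complex.ofReal_re _
    have h4 := norm_inner_le_norm (𝕜 := ℂ) q x
    rw [h1, ← h3, Complex.norm_real, Real.norm_of_nonneg (sq_nonneg _)] at h4
    rw [← h3]
    nlinarith [norm_nonneg q, norm_nonneg x]
  refine opNorm_le_of_re_inner_le zero_le_one fun x y hx hy => ?_
  have hx' := bessel x
  have hy' := bessel y
  rw [hx] at hx'
  rw [hy] at hy'
  have h1 : ‖⟪A (U.adjoint x), U.adjoint y⟫_ℂ‖ ≤ ‖U.adjoint x‖ * ‖U.adjoint y‖ := by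
    refine (norm_inner_le_norm _ _).trans ?_
    gcongr
    simpa using A.le_of_opNorm_le hA (U.adjoint x)
  have h2 : ‖⟪B (V.adjoint x), V.adjoint y⟫_ℂ‖ ≤ ‖V.adjoint x‖ * ‖V.adjoint y‖ := by
    refine (norm_inner_le_norm _ _).trans ?_
    gcongr
    simpa using B.le_of_opNorm_le hB (V.adjoint x)
  rw [inner_glue]
  refine (Complex.re_le_norm _).trans ((norm_add_le _ _).trans ?_)
  nlinarith [sq_nonneg (‖U.adjoint x‖ - ‖U.adjoint y‖), sq_nonneg (‖V.adjoint x‖ - ‖V.adjoint y‖)]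

/-- The ranges of `U` and `V` need not span `H`, so gluing 1 with 1 gives only a projection.
Exponent 0 is therefore set to 1 separately, which preserves multiplicativity. -/
theorem exists_glue (hU : U.adjoint * U = 1) (hV : V.adjoint * V = 1)
    (hUV : U.adjoint * V = 0) (hVU : V.adjoint * U = 0) (S R : CommContractions H d) :
    ∃ T : CommContractions H d, ∀ n,
      T.monomial n = if n = 0 then 1 else glue U V (S.monomial n) (R.monomial n) := by
  refine exists_monomial_eq _ (if_pos rfl) (fun n m => ?_) (fun n => ?_)
  · by_cases hn : n = 0
    · simp [hn]
    by_cases hm : m = 0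
    · simp [hm]
    have hnm : n + m ≠ 0 := fun h => hn (add_eq_zero.1 h).1
    rw [if_neg hn, if_neg hm, if_neg hnm, glue_mul_glue hU hV hUV hVU, monomial_add, monomial_add]
  · split_ifs
    · exact norm_id_le
    · exact norm_glue_le hU hV hUV hVU (S.norm_monomial_le n) (R.norm_monomial_le n)

end Splitting

/-- A tuple whose compression by an isometry violates the von Neumann inequality violates it. -/
theorem SatisfiesVonNeumann.of_compression {T R : CommContractions H d} {V : H →L[ℂ] H}
    (hV : V.adjoint * V = 1) (h : ∀ n, V.adjoint * T.monomial n * V = R.monomial n)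
    (hT : T.SatisfiesVonNeumann) : R.SatisfiesVonNeumann := by
  intro p
  have hp : R.evalPoly p = V.adjoint * T.evalPoly p * V := by
    simp only [evalPoly, Finset.mul_sum, Finset.sum_mul, mul_smul_comm, smul_mul_assoc, h]
  have hV1 : ‖V‖ ≤ 1 := by
    have h1 := V.norm_adjoint_comp_self
    rw [← ContinuousLinearMap.mul_def, hV] at h1
    have h2 : ‖(1 : H →L[ℂ] H)‖ ≤ 1 := ContinuousLinearMap.norm_id_le
    nlinarith [norm_nonneg V]
  have hV2 : ‖V.adjoint‖ ≤ 1 := by rwa [LinearIsometryEquiv.norm_map]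
  refine le_trans ?_ (hT p)
  rw [hp]
  calc ‖V.adjoint * T.evalPoly p * V‖ ≤ ‖V.adjoint‖ * ‖T.evalPoly p‖ * ‖V‖ :=
        (norm_mul_le _ _).trans (by gcongr; exact norm_mul_le _ _)
    _ ≤ 1 * ‖T.evalPoly p‖ * 1 := by gcongr
    _ = ‖T.evalPoly p‖ := by ring

theorem dense_compl_vonNeumannTuples [TopologicalSpace.SeparableSpace H]
    (hH : ¬ FiniteDimensional ℂ H) (hne : vonNeumannTuples H d ≠ Set.univ) :
    Dense (vonNeumannTuples H d)ᶜ := by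
  obtain ⟨R, hR⟩ := (Set.ne_univ_iff_exists_notMem _).1 hne
  obtain ⟨b⟩ := exists_hilbertBasis_nat hH
  obtain ⟨U, V, hU, hV, hUV, hVU, hUx, hVx⟩ := b.exists_asymptotic_splitting
  intro S
  choose T hT using fun k => exists_glue (hU k) (hV k) (hUV k) (hVU k) S R
  refine mem_closure_of_tendsto (f := T) (b := atTop) ?_ (Eventually.of_forall fun k hk => hR ?_)
  · refine tendsto_of_coeff fun n x y => ?_
    by_cases hn : n = 0
    · simp [coeff, hT, hn, monomial_zero]
    · simp only [coeff, hT, if_neg hn, ContinuousLinearMap.inner_glue]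
      have h1 := (((S.monomial n).continuous.tendsto _).comp (hUx x)).inner (𝕜 := ℂ) (hUx y)
      have h2 := (((R.monomial n).continuous.tendsto _).comp (hVx x)).inner (𝕜 := ℂ) (hVx y)
      simpa [Function.comp_def] using h1.add h2
  · refine SatisfiesVonNeumann.of_compression (hV k) (fun n => ?_) hk
    rw [hT]
    split_ifs with hn
    · rw [mul_one, hV, hn, monomial_zero]
    · exact ContinuousLinearMap.adjoint_mul_glue_mul (hV k) (hUV k) _ _

end CommContractions

/-! ### The Baire property. -/

namespace CommContractions

variable {H : Type*} [NormedAddCommGroup H] [InnerProductSpace ℂ H] {d : ℕ}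

variable (H d) in
/-- The families of sesquilinear contractive kernels indexed by the exponents, with the inner
product at the exponent `0`. -/
def kernels : Set ((Fin d → ℕ) → H → H → ℂ) :=
  {φ | (∀ n x y, ‖φ n x y‖ ≤ ‖x‖ * ‖y‖) ∧
    (∀ n x x' y, φ n (x + x') y = φ n x y + φ n x' y) ∧
    (∀ n (c : ℂ) x y, φ n (c • x) y = (starRingEnd ℂ) c * φ n x y) ∧
    (∀ n x y y', φ n x (y + y') = φ n x y + φ n x y') ∧
    (∀ n (c : ℂ) x y, φ n x (c • y) = c * φ n x y) ∧
    ∀ x y, φ 0 x y = ⟪x, y⟫_ℂ}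

theorem isCompact_kernels : IsCompact (kernels H d) := by
  have hK : IsCompact (Set.univ.pi fun _ : Fin d → ℕ => Set.univ.pi fun x : H =>
      Set.univ.pi fun y : H => Metric.closedBall (0 : ℂ) (‖x‖ * ‖y‖)) :=
    isCompact_univ_pi fun _ => isCompact_univ_pi fun _ => isCompact_univ_pi fun _ =>
      isCompact_closedBall _ _
  refine hK.of_isClosed_subset ?_ fun φ hφ => ?_
  · simp only [kernels, Set.ofPred_and, Set.ofPred_forall]
    have hc (n : Fin d → ℕ) (x y : H) :
        Continuous fun φ : (Fin d → ℕ) → H → H → ℂ => φ n x y := by fun_prop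
    refine IsClosed.inter ?_ (IsClosed.inter ?_ (IsClosed.inter ?_ (IsClosed.inter ?_
      (IsClosed.inter ?_ ?_))))
    · exact isClosed_iInter fun n => isClosed_iInter fun x => isClosed_iInter fun y =>
        isClosed_le (hc n x y).norm continuous_const
    · exact isClosed_iInter fun n => isClosed_iInter fun x => isClosed_iInter fun x' =>
        isClosed_iInter fun y => isClosed_eq (hc _ _ _) ((hc _ _ _).add (hc _ _ _))
    · exact isClosed_iInter fun n => isClosed_iInter fun c => isClosed_iInter fun x =>
        isClosed_iInter fun y => isClosed_eq (hc _ _ _) (continuous_const.mul (hc _ _ _))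
    · exact isClosed_iInter fun n => isClosed_iInter fun x => isClosed_iInter fun y =>
        isClosed_iInter fun y' => isClosed_eq (hc _ _ _) ((hc _ _ _).add (hc _ _ _))
    · exact isClosed_iInter fun n => isClosed_iInter fun c => isClosed_iInter fun x =>
        isClosed_iInter fun y => isClosed_eq (hc _ _ _) (continuous_const.mul (hc _ _ _))
    · exact isClosed_iInter fun x => isClosed_iInter fun y =>
        isClosed_eq (hc _ _ _) continuous_const
  · simpa [Set.mem_pi] using hφ.1

theorem coeff_mem_kernels (S : CommContractions H d) : S.coeff ∈ kernels H d := by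
  refine ⟨S.norm_coeff_le, ?_, ?_, ?_, ?_, ?_⟩
  · intro n x x' y
    simp [coeff]
  · intro n c x y
    simp only [coeff, map_smul, inner_smul_left]
  · intro n x y y'
    simp [coeff]
  · intro n c x y
    simp only [coeff, inner_smul_right]
  · intro x y
    simp [coeff, monomial_zero]

variable [CompleteSpace H]

/-- Contractive sesquilinear kernels are the matrix coefficients of contractions. -/
theorem exists_operator_of_mem_kernels {φ : (Fin d → ℕ) → H → H → ℂ} (hφ : φ ∈ kernels H d)
    (n : Fin d → ℕ) : ∃ T : H →L[ℂ] H, ‖T‖ ≤ 1 ∧ ∀ x y, ⟪T x, y⟫_ℂ = φ n x y := by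
  obtain ⟨hb, h1, h2, h3, h4, -⟩ := hφ
  let B : H →L⋆[ℂ] H →L[ℂ] ℂ := LinearMap.mkContinuous₂
    (LinearMap.mk₂'ₛₗ (starRingEnd ℂ) (RingHom.id ℂ) (φ n) (h1 n) (h2 n) (h3 n) (h4 n)) 1
    fun x y => by simpa using hb n x y
  have hB (x y : H) : ⟪InnerProductSpace.continuousLinearMapOfBilin B x, y⟫_ℂ = φ n x y := by
    rw [InnerProductSpace.continuousLinearMapOfBilin_apply]
    rfl
  refine ⟨_, ?_, hB⟩
  refine ContinuousLinearMap.opNorm_le_of_re_inner_le zero_le_one fun x y hx hy => ?_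
  rw [hB]
  simpa [hx, hy] using (Complex.re_le_norm _).trans (hb n x y)

/-- The partial sums of the matrix coefficients of a product converge. -/
theorem tendsto_sum_inner (b : HilbertBasis ℕ ℂ H) (S T : H →L[ℂ] H) (x y : H) :
    Tendsto (fun K => ∑ k ∈ Finset.range K, ⟪T x, b k⟫_ℂ * ⟪S (b k), y⟫_ℂ) atTop
      (𝓝 ⟪(S * T) x, y⟫_ℂ) := by
  have h := (b.hasSum_inner_mul_inner (T x) (S.adjoint y)).tendsto_sum_nat
  simpa [ContinuousLinearMap.adjoint_inner_right] using h

/-- Among the kernels, those that come from tuples are singled out by multiplicativity, which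
amounts to countably many conditions of type `Gδ`. -/
theorem range_coeff (b : HilbertBasis ℕ ℂ H) :
    Set.range (coeff : CommContractions H d → _) = kernels H d ∩
      ⋂ (n : Fin d → ℕ) (m : Fin d → ℕ) (i : ℕ) (j : ℕ) (q : ℕ) (N : ℕ), ⋃ (K : ℕ) (_ : N ≤ K),
        {φ | ‖∑ k ∈ Finset.range K, φ m (b i) (b k) * φ n (b k) (b j) - φ (n + m) (b i) (b j)‖ <
          1 / ((q : ℝ) + 1)} := by
  ext φ
  simp only [Set.mem_range, Set.mem_inter_iff, Set.mem_iInter, Set.mem_iUnion, Set.mem_ofPred_eq,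
    exists_prop]
  constructor
  · rintro ⟨S, rfl⟩
    refine ⟨S.coeff_mem_kernels, fun n m i j q N => ?_⟩
    have h := tendsto_sum_inner b (S.monomial n) (S.monomial m) (b i) (b j)
    rw [← monomial_add] at h
    obtain ⟨K, hK⟩ := ((Metric.tendsto_nhds.1 h _ (Nat.one_div_pos_of_nat (α := ℝ) (n := q))).and
      (eventually_ge_atTop N)).exists
    rw [dist_eq_norm] at hK
    exact ⟨K, hK.2, hK.1⟩
  -- The hypothesis only says that the wanted value is a cluster point of the partial sums, which
  -- keeps the condition Gδ. This suffices, as for operators the sums converge.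
  · rintro ⟨hφ, h⟩
    choose T hT1 hT using exists_operator_of_mem_kernels hφ
    have h0 : T 0 = 1 := ContinuousLinearMap.ext fun x => ext_inner_right ℂ fun y => by
      rw [hT, hφ.2.2.2.2.2]; rfl
    have hadd (n m : Fin d → ℕ) : T (n + m) = T n * T m := by
      refine b.ext_clm fun i => b.ext_inner fun j => ?_
      rw [← inner_conj_symm, ← inner_conj_symm _ ((T n * T m) _)]
      congr 1
      have hlim := tendsto_sum_inner b (T n) (T m) (b i) (b j)
      refine dist_le_zero.1 (le_of_forall_pos_lt_add fun ε hε => ?_)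
      obtain ⟨q, hq⟩ := exists_nat_one_div_lt (half_pos hε)
      obtain ⟨N, hN⟩ := eventually_atTop.1 (Metric.tendsto_nhds.1 hlim _ (half_pos hε))
      obtain ⟨K, hK, hK'⟩ := h n m i j q N
      have h1 := hN K hK
      simp only [← hT] at hK'
      rw [← dist_eq_norm, dist_comm] at hK'
      linarith [dist_triangle _ _ _ |>.trans_lt (add_lt_add (hK'.trans hq) h1)]
    obtain ⟨S, hS⟩ := exists_monomial_eq T h0 hadd hT1
    refine ⟨S, ?_⟩
    ext n x y
    rw [coeff, hS, hT]

/-- The commuting tuples of contractions on an infinite-dimensional separable Hilbert space form a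
Baire space. -/
theorem baireSpace (b : HilbertBasis ℕ ℂ H) : BaireSpace (CommContractions H d) := by
  have hC : CompactSpace (kernels H d) := isCompact_iff_compactSpace.1 isCompact_kernels
  let f : CommContractions H d → kernels H d := fun S => ⟨S.coeff, S.coeff_mem_kernels⟩
  have hf : IsEmbedding f :=
    .of_comp (by exact isInducing_coeff.continuous.subtype_mk _) continuous_subtype_val
      ⟨isInducing_coeff, coeff_injective⟩
  have hrange : Set.range f = Subtype.val ⁻¹' Set.range (coeff : CommContractions H d → _) := by
    ext φ
    simp [f, Subtype.ext_iff]
  have hG : IsGδ (Set.range f) := by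
    rw [hrange, range_coeff b, Set.preimage_inter, Subtype.coe_preimage_self, Set.univ_inter]
    refine IsGδ.preimage continuous_subtype_val ?_
    refine .iInter fun n => .iInter fun m => .iInter fun i => .iInter fun j => .iInter fun q =>
      .iInter fun N => IsOpen.isGδ ?_
    refine isOpen_iUnion fun K => isOpen_iUnion fun _ => isOpen_lt ?_ continuous_const
    fun_prop
  -- A Gδ subset of a compact Hausdorff space is Baire.
  have := hG.baireSpace_of_t2Space_locallyCompactSpace
  exact hf.toHomeomorph.symm.baireSpace

end CommContractions

/-! ### The dichotomy. -/

theorem isMeagre_vonNeumannTuples {H : Type*} [NormedAddCommGroup H] [InnerProductSpace ℂ H]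
    [CompleteSpace H] [TopologicalSpace.SeparableSpace H] (hH : ¬ FiniteDimensional ℂ H) {d : ℕ}
    (hne : vonNeumannTuples H d ≠ Set.univ) : IsMeagre (vonNeumannTuples H d) :=
  residual_of_dense_open (isClosed_vonNeumannTuples d).isOpen_compl
    (CommContractions.dense_compl_vonNeumannTuples hH hne)

theorem mainTheorem5 {H : Type*} [NormedAddCommGroup H] [InnerProductSpace ℂ H] [CompleteSpace H]
    (hH : ¬ FiniteDimensional ℂ H) (d : ℕ) :
    IsClosed (vonNeumannTuples H d) ∧
    (3 ≤ d → vonNeumannTuples H d ≠ Set.univ) ∧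
    (TopologicalSpace.SeparableSpace H →
      Xor (vonNeumannTuples H d = Set.univ) (IsMeagre (vonNeumannTuples H d)) ∧
      (3 ≤ d →
        IsMeagre (vonNeumannTuples H d) ∧
        {S : CommContractions H d | ¬ S.SatisfiesVonNeumann} ∈
          residual (CommContractions H d))) := by
  have hne (hd : 3 ≤ d) : vonNeumannTuples H d ≠ Set.univ := by
    obtain ⟨e, he⟩ := exists_orthonormal_nat hH
    obtain ⟨S, hS⟩ := exists_not_satisfiesVonNeumann (he.comp _ (Fin.val_injective (n := 5))) hd
    exact fun h => hS (h.ge (Set.mem_univ S))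
  refine ⟨isClosed_vonNeumannTuples d, hne, fun hsep => ⟨?_, fun hd => ?_⟩⟩
  · by_cases h : vonNeumannTuples H d = Set.univ
    -- A nonempty Baire space is not meagre in itself; the zero tuple witnesses nonemptiness.
    · obtain ⟨b⟩ := exists_hilbertBasis_nat hH
      have := CommContractions.baireSpace (d := d) b
      have hS : (Set.univ : Set (CommContractions H d)).Nonempty :=
        ⟨⟨fun _ => 0, fun _ => by simp, fun _ _ => Commute.zero_left _⟩, Set.mem_univ _⟩
      exact Or.inl ⟨h, h ▸ not_isMeagre_of_isOpen isOpen_univ hS⟩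
    · exact Or.inr ⟨isMeagre_vonNeumannTuples hH h, h⟩
  · have h := isMeagre_vonNeumannTuples hH (hne hd)
    exact ⟨h, h⟩
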